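/- There are absolute constants $c, c' > 0$ such that for every $K \ge 0$ there is a constant $C > 0$, depending only on $K$, with the following property. Let $d, k, n, r$ be nonnegative integers with $nr \ge 2$ (so $n, r \ge 1$), let $\varepsilon_1, \varepsilon_2 \in (0,1)$, and let $R$ be a random $d \times k$ matrix whose entries are i.i.d. with mean zero, variance $1/k$, and are sub-Gaussian with normalized parameter $K$, i.e. $\mathbb{E}\exp(t \sqrt{k} R_{ij}) \le \exp(K t^2/2)$ for all $t \in \mathbb{R}$. If $$k \ge C \max\left\{ \varepsilon_1^{-2}\, r\,(\log r + \log n),\ \varepsilon_2^{-2} \log(\varepsilon_2^{-1})\, r \right\},$$ then, with $\delta_1 = \exp(-c' \log(nr))$ and $\delta_2 = \exp(-c \log(\varepsilon_2^{-1})\, r)$, both of which lie in $(0,1)$: (C1) $R$ is a $(2nr, \varepsilon_1/\sqrt{r}, \delta_1)$-Johnson--Lindenstrauss transform: for any fixed points $v_1, \ldots, v_{2nr} \in \mathbb{R}^d$, with probability at least $1 - \delta_1$, $$(1 - \varepsilon_1/\sqrt{r}) \|v_i\|_2^2 \le \|R^{\top} v_i\|_2^2 \le (1 + \varepsilon_1/\sqrt{r})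 \|v_i\|_2^2 \quad \text{for all } i = 1, \ldots, 2nr;$$ (C2) $R$ is an $(r, \varepsilon_2, \delta_2)$-restricted isometry: for any fixed $r$-dimensional linear subspace $\mathcal{V} \subset \mathbb{R}^d$, with probability at least $1 - \delta_2$, $$(1 - \varepsilon_2) \|v\|_2 \le \|R^{\top} v\|_2 \le (1 + \varepsilon_2) \|v\|_2 \quad \text{for all } v \in \mathcal{V}.$$ Moreover, with the same constants, the same holds if in the second term of the maximum and in $\delta_2$ the factor $r$ is replaced by $\max\{r, \log n\}$. -/

import Mathlib

open MeasureTheory ProbabilityTheory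
open scoped NNReal Matrix

/-- The image `Mᵀ v`, as a vector of Euclidean space, of `v ∈ ℝᵈ` under the transpose of a
`d × k` matrix `M`. -/
noncomputable def transposeApply {d k : ℕ} (M : Matrix (Fin d) (Fin k) ℝ)
    (v : EuclideanSpace ℝ (Fin d)) : EuclideanSpace ℝ (Fin k) :=
  WithLp.toLp 2 (Mᵀ *ᵥ v.ofLp)

/-- The random `d × k` matrix `R` is an `(m, ε, δ)`-Johnson-Lindenstrauss transform: for every
fixed choice of `m` points of `ℝᵈ`, with probability at least `1 - δ` the squared Euclidean norms of
all of them are preserved by `Rᵀ` up to relative error `ε`. -/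
def IsJLT {Ω : Type*} [MeasurableSpace Ω] (P : Measure Ω) {d k : ℕ}
    (R : Ω → Matrix (Fin d) (Fin k) ℝ) (m : ℕ) (ε δ : ℝ) : Prop :=
  (0 < ε ∧ ε < 1) ∧ (0 < δ ∧ δ < 1) ∧
    ∀ v : Fin m → EuclideanSpace ℝ (Fin d),
      1 - δ ≤ P.real {ω | ∀ i : Fin m,
        (1 - ε) * ‖v i‖ ^ 2 ≤ ‖transposeApply (R ω) (v i)‖ ^ 2 ∧
          ‖transposeApply (R ω) (v i)‖ ^ 2 ≤ (1 + ε) * ‖v i‖ ^ 2}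

/-- The random `d × k` matrix `R` is an `(s, ε, δ)`-restricted isometry: for every fixed
`s`-dimensional subspace `V` of `ℝᵈ`, with probability at least `1 - δ` the Euclidean norms of all
`v ∈ V` are simultaneously preserved by `Rᵀ` up to relative error `ε`. -/
def IsRestrictedIsometry {Ω : Type*} [MeasurableSpace Ω] (P : Measure Ω) {d k : ℕ}
    (R : Ω → Matrix (Fin d) (Fin k) ℝ) (s : ℕ) (ε δ : ℝ) : Prop :=
  (0 < ε ∧ ε < 1) ∧ (0 < δ ∧ δ < 1) ∧
    ∀ V : Submodule ℝ (EuclideanSpace ℝ (Fin d)), Module.finrank ℝ V = s →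
      1 - δ ≤ P.real {ω | ∀ v ∈ V,
        (1 - ε) * ‖v‖ ≤ ‖transposeApply (R ω) v‖ ∧
          ‖transposeApply (R ω) v‖ ≤ (1 + ε) * ‖v‖}

/-- The entries of the random `d × k` matrix `R` are i.i.d. with mean zero and variance `1 / k`,
and sub-Gaussian: the unit-variance rescaling `√k R i j` has sub-Gaussian parameter `K`, i.e.
`𝔼 exp (t √k R i j) ≤ exp (K t² / 2)` for all real `t`. -/
structure HasIIDSubgaussianEntries {Ω : Type*} [MeasurableSpace Ω] (P : Measure Ω) {d k : ℕ}
    (R : Ω → Matrix (Fin d) (Fin k) ℝ) (K : ℝ≥0) : Prop where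
  indep : iIndepFun (fun (p : Fin d × Fin k) (ω : Ω) => R ω p.1 p.2) P
  identDistrib : ∀ p q : Fin d × Fin k,
    IdentDistrib (fun ω => R ω p.1 p.2) (fun ω => R ω q.1 q.2) P P
  mean_eq_zero : ∀ i j, ∫ ω, R ω i j ∂P = 0
  variance_eq : ∀ i j, variance (fun ω => R ω i j) P = 1 / (k : ℝ)
  subgaussian : ∀ i j, HasSubgaussianMGF (fun ω => Real.sqrt k * R ω i j) K P

/-! For a unit vector `u`, the coordinates of `√k Rᵀu` are independent, have second moment 1 and are
again sub-Gaussian with parameter `K`, so `‖Rᵀu‖² - 1` is an average of centred sub-exponential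
variables. Bernstein's inequality (`measure_sum_sq_deviation_le`) bounds its tail at `ε` by `2
exp(-kε²/(1024K²))`. A union bound over `2nr` points at accuracy `ε₁/√r` gives (C1).

For (C2), polarization and a half-net of the unit sphere of `V` reduce uniform control to at most `2
· 25^r` fixed vectors (`abs_norm_sq_sub_le_of_half_net`).

The delicate point is `ε₂` near 1: there `log ε₂⁻¹` tends to 0, so the second term of the maximum
cannot pay for the factor `25^r`. Accuracy 1/2 is then proved instead, paid for by the first term,
which is at least `r log(nr)` because `ε₁ < 1`. Both versions of the theorem are one statement with
a parameter `M`, equal to `r` or `max r (log n)`. -/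

section Independence

variable {Ω : Type*} [MeasurableSpace Ω] {P : Measure Ω}

/-- If the variables `X i j` are independent, then so are the blocks `(X i j)ⱼ`. -/
lemma iIndepFun_curry_of_measurable {ι κ 𝓧 : Type*} [MeasurableSpace 𝓧] {X : ι → κ → Ω → 𝓧}
    (mX : ∀ i j, Measurable (X i j)) (h : iIndepFun (fun p : ι × κ => X p.1 p.2) P) :
    iIndepFun (fun i ω j => X i j ω) P := by
  have := h.isProbabilityMeasure
  have : ∀ i j, IsProbabilityMeasure (P.map (X i j)) :=
    fun i j => Measure.isProbabilityMeasure_map (mX i j).aemeasurable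
  have : ∀ i, IsProbabilityMeasure (P.map (fun ω j => X i j ω)) :=
    fun i => Measure.isProbabilityMeasure_map (Measurable.aemeasurable (by fun_prop))
  have hs : iIndepFun (fun (p : (_ : ι) × κ) ω => X p.1 p.2 ω) P :=
    h.precomp (g := fun p : (_ : ι) × κ => (p.1, p.2)) (Equiv.sigmaEquivProd ι κ).injective
  have h2 : ∀ i, iIndepFun (X i) P := fun i =>
    h.precomp (g := fun j : κ => (i, j)) (Prod.mk_right_injective i)
  have hc : (MeasurableEquiv.piCurry fun (_ : ι) (_ : κ) => 𝓧) ∘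
      (fun ω (p : (_ : ι) × κ) => X p.1 p.2 ω) = fun ω i j => X i j ω := by
    ext; simp [Sigma.curry]
  rw [iIndepFun_iff_map_fun_eq_infinitePi_map (by fun_prop), ← hc,
    ← Measure.map_map (by fun_prop) (by fun_prop),
    (iIndepFun_iff_map_fun_eq_infinitePi_map (by fun_prop)).1 hs,
    Measure.infinitePi_map_piCurry (fun i j => P.map (X i j))]
  congrm Measure.infinitePi fun i => ?_
  rw [(iIndepFun_iff_map_fun_eq_infinitePi_map (by fun_prop)).1 (h2 i)]

lemma iIndepFun_curry {ι κ 𝓧 : Type*} [Countable κ] [MeasurableSpace 𝓧] {X : ι → κ → Ω → 𝓧}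
    (mX : ∀ i j, AEMeasurable (X i j) P) (h : iIndepFun (fun p : ι × κ => X p.1 p.2) P) :
    iIndepFun (fun i ω j => X i j ω) P := by
  have hY : iIndepFun (fun p : ι × κ => (mX p.1 p.2).mk) P :=
    h.congr fun p => (mX p.1 p.2).ae_eq_mk
  refine (iIndepFun_curry_of_measurable (X := fun i j => (mX i j).mk)
    (fun i j => (mX i j).measurable_mk) hY).congr fun i => ?_
  have := ae_all_iff.2 fun j => (mX i j).ae_eq_mk
  filter_upwards [this] with ω hω
  exact funext fun j => (hω j).symm

end Independence

/-! ### Squares of sub-Gaussian variables and Bernstein's inequality -/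

section Subgaussian

variable {Ω : Type*} [MeasurableSpace Ω] {P : Measure Ω}

lemma ProbabilityTheory.HasSubgaussianMGF.mono {X : Ω → ℝ} {c c' : ℝ≥0}
    (h : HasSubgaussianMGF X c P) (hc : c ≤ c') : HasSubgaussianMGF X c' P where
  integrable_exp_mul := h.integrable_exp_mul
  mgf_le t := (h.mgf_le t).trans (by gcongr)

lemma lintegral_exp_sq_div_four_gaussianReal :
    ∫⁻ g, ENNReal.ofReal (Real.exp (g ^ 2 / 4)) ∂(gaussianReal 0 1) =
      ENNReal.ofReal (Real.sqrt 2) := by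
  rw [gaussianReal_of_var_ne_zero _ one_ne_zero,
    lintegral_withDensity_eq_lintegral_mul _ (by fun_prop) (by fun_prop)]
  have h : ∀ g : ℝ, (gaussianPDF 0 1 * fun g => ENNReal.ofReal (Real.exp (g ^ 2 / 4))) g =
      ENNReal.ofReal ((Real.sqrt (2 * Real.pi))⁻¹ * Real.exp (-(1 / 4) * g ^ 2)) := by
    intro g
    rw [Pi.mul_apply, gaussianPDF, ← ENNReal.ofReal_mul (gaussianPDFReal_nonneg _ _ _),
      gaussianPDFReal, mul_assoc, ← Real.exp_add]
    congr 3
    · simp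
    · simp; ring
  simp_rw [h]
  rw [← ofReal_integral_eq_lintegral_ofReal
    ((integrable_exp_neg_mul_sq (by norm_num)).const_mul _) (by filter_upwards with g; positivity),
    integral_const_mul, integral_gaussian]
  congr 1
  rw [← Real.sqrt_inv, ← Real.sqrt_mul (by positivity)]
  congr 1
  field_simp
  norm_num

/-- The square of a sub-Gaussian variable has a finite exponential moment. -/
lemma ProbabilityTheory.HasSubgaussianMGF.lintegral_exp_sq_le [IsProbabilityMeasure P]
    {Z : Ω → ℝ} {K : ℝ≥0} (hK : 0 < K) (h : HasSubgaussianMGF Z K P) :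
    ∫⁻ ω, ENNReal.ofReal (Real.exp ((4 * (K : ℝ))⁻¹ * Z ω ^ 2)) ∂P ≤
      ENNReal.ofReal (Real.sqrt 2) := by
  have hK' : (0 : ℝ) < K := hK
  -- Gaussian linearization: with `s² = 1/(2K)` and `g` standard normal, `exp(z²/(4K)) = 𝔼
  -- exp(szg)`. After Tonelli, the sub-Gaussian bound at `sg` leaves `exp(g²/4)`.
  set s : ℝ := Real.sqrt ((2 * (K : ℝ))⁻¹) with hs
  have hs2 : s ^ 2 = (2 * (K : ℝ))⁻¹ := Real.sq_sqrt (by positivity)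
  have hZ := h.aemeasurable
  have h1 : ∀ z : ℝ, ENNReal.ofReal (Real.exp ((4 * (K : ℝ))⁻¹ * z ^ 2)) =
      ∫⁻ g, ENNReal.ofReal (Real.exp (s * z * g)) ∂(gaussianReal 0 1) := by
    intro z
    rw [← ofReal_integral_eq_lintegral_ofReal (integrable_exp_mul_gaussianReal _)
      (by filter_upwards with g; positivity)]
    have := congrFun (mgf_id_gaussianReal (μ := 0) (v := 1)) (s * z)
    simp only [mgf, id] at this
    rw [this, mul_pow, hs2]
    congr 2
    push_cast
    field_simp
    ring
  have h2 : ∀ g : ℝ, ∫⁻ ω, ENNReal.ofReal (Real.exp (s * Z ω * g)) ∂P ≤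
      ENNReal.ofReal (Real.exp (g ^ 2 / 4)) := by
    intro g
    have he : ∀ ω, s * Z ω * g = (s * g) * Z ω := fun ω => by ring
    simp_rw [he]
    rw [← ofReal_integral_eq_lintegral_ofReal (h.integrable_exp_mul _)
      (by filter_upwards with g; positivity)]
    refine ENNReal.ofReal_le_ofReal ((h.mgf_le (s * g)).trans_eq ?_)
    rw [mul_pow, hs2]
    congr 1
    field_simp
    ring
  calc ∫⁻ ω, ENNReal.ofReal (Real.exp ((4 * (K : ℝ))⁻¹ * Z ω ^ 2)) ∂P
      = ∫⁻ ω, ∫⁻ g, ENNReal.ofReal (Real.exp (s * Z ω * g)) ∂(gaussianReal 0 1) ∂P := by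
        simp_rw [h1]
    _ = ∫⁻ g, ∫⁻ ω, ENNReal.ofReal (Real.exp (s * Z ω * g)) ∂P ∂(gaussianReal 0 1) := by
        refine lintegral_lintegral_swap ?_
        have := hZ.comp_fst (ν := gaussianReal 0 1)
        simp only [Function.uncurry_def]
        fun_prop
    _ ≤ ∫⁻ g, ENNReal.ofReal (Real.exp (g ^ 2 / 4)) ∂(gaussianReal 0 1) := lintegral_mono h2
    _ = _ := lintegral_exp_sq_div_four_gaussianReal

lemma ProbabilityTheory.HasSubgaussianMGF.integrable_exp_sq [IsProbabilityMeasure P]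
    {Z : Ω → ℝ} {K : ℝ≥0} (hK : 0 < K) (h : HasSubgaussianMGF Z K P) :
    Integrable (fun ω => Real.exp ((4 * (K : ℝ))⁻¹ * Z ω ^ 2)) P := by
  have hZ := h.aemeasurable
  have hm : AEMeasurable (fun ω => Real.exp ((4 * (K : ℝ))⁻¹ * Z ω ^ 2)) P := by fun_prop
  refine ⟨hm.aestronglyMeasurable, ?_⟩
  rw [hasFiniteIntegral_iff_ofReal (by filter_upwards with ω; positivity)]
  exact (h.lintegral_exp_sq_le hK).trans_lt ENNReal.ofReal_lt_top

lemma ProbabilityTheory.HasSubgaussianMGF.integral_exp_sq_le [IsProbabilityMeasure P]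
    {Z : Ω → ℝ} {K : ℝ≥0} (hK : 0 < K) (h : HasSubgaussianMGF Z K P) :
    ∫ ω, Real.exp ((4 * (K : ℝ))⁻¹ * Z ω ^ 2) ∂P ≤ Real.sqrt 2 := by
  have := h.lintegral_exp_sq_le hK
  rw [← ofReal_integral_eq_lintegral_ofReal (h.integrable_exp_sq hK)
    (by filter_upwards with g; positivity)] at this
  exact (ENNReal.ofReal_le_ofReal_iff (by positivity)).1 this

lemma Real.exp_le_one_add_add_sq_mul_exp_abs (x : ℝ) :
    Real.exp x ≤ 1 + x + x ^ 2 * Real.exp |x| := by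
  have h := Complex.norm_exp_sub_sum_le_norm_mul_exp (x : ℂ) 2
  have h1 : Complex.exp x - ∑ m ∈ Finset.range 2, (x : ℂ) ^ m / m.factorial =
      ((Real.exp x - (1 + x) : ℝ) : ℂ) := by
    simp [Finset.sum_range_succ]
  rw [h1, Complex.norm_real, Complex.norm_real, Real.norm_eq_abs, Real.norm_eq_abs, sq_abs] at h
  linarith [le_of_abs_le h]

/-- The factor `w²` of the Taylor remainder is absorbed into a second copy of `exp(η|w|)`; hence the
exponent `2η`. -/
lemma Real.exp_mul_le_of_abs_le {s η w : ℝ} (hη : 0 < η) (hs : |s| ≤ η) :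
    Real.exp (s * w) ≤ 1 + s * w + s ^ 2 * (2 / η ^ 2) * Real.exp (2 * η * |w|) := by
  have h1 := Real.exp_le_one_add_add_sq_mul_exp_abs (s * w)
  have h2 : Real.exp |s * w| ≤ Real.exp (η * |w|) := by
    rw [abs_mul]; gcongr
  have h3 : w ^ 2 ≤ 2 / η ^ 2 * Real.exp (η * |w|) := by
    have := Real.quadratic_le_exp_of_nonneg (x := η * |w|) (by positivity)
    rw [div_mul_eq_mul_div, le_div_iff₀ (by positivity), ← sq_abs w]
    have : 0 ≤ η * |w| := by positivity
    nlinarith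
  have h4 : Real.exp (2 * η * |w|) = Real.exp (η * |w|) * Real.exp (η * |w|) := by
    rw [← Real.exp_add]; ring_nf
  have h5 : (s * w) ^ 2 * Real.exp |s * w| ≤
      s ^ 2 * (2 / η ^ 2) * Real.exp (2 * η * |w|) := by
    calc (s * w) ^ 2 * Real.exp |s * w| ≤ (s * w) ^ 2 * Real.exp (η * |w|) := by gcongr
      _ = s ^ 2 * w ^ 2 * Real.exp (η * |w|) := by ring
      _ ≤ s ^ 2 * (2 / η ^ 2 * Real.exp (η * |w|)) * Real.exp (η * |w|) := by gcongr
      _ = _ := by rw [h4]; ring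
  linarith

/-- The choice `η = 1/(8K)` makes `2η = 1/(4K)`, the exponent at which `z²` has a bounded
exponential moment. -/
lemma Real.exp_mul_sq_sub_one_le {z s K : ℝ}
    (hK : 0 < K) (hs : |s| ≤ (8 * K)⁻¹) :
    Real.exp (s * (z ^ 2 - 1)) ≤ 1 + s * (z ^ 2 - 1) +
      s ^ 2 * (128 * K ^ 2) * Real.exp (4 * K)⁻¹ * Real.exp ((4 * K)⁻¹ * z ^ 2) := by
  have h := Real.exp_mul_le_of_abs_le (w := z ^ 2 - 1) (η := (8 * K)⁻¹) (by positivity) hs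
  have h1 : 2 / (8 * K)⁻¹ ^ 2 = 128 * K ^ 2 := by field_simp; norm_num
  have h2 : 2 * (8 * K)⁻¹ = (4 * K)⁻¹ := by field_simp; norm_num
  have h3 : |z ^ 2 - 1| ≤ 1 + z ^ 2 := by
    rw [abs_le]; constructor <;> nlinarith [sq_nonneg z]
  rw [h1, h2] at h
  refine h.trans ?_
  rw [mul_assoc _ (Real.exp _), ← Real.exp_add, ← mul_one_add]
  gcongr

/-- The centred square of a normalized sub-Gaussian variable is sub-exponential. -/
lemma ProbabilityTheory.HasSubgaussianMGF.integrable_and_mgf_sq_sub_one_le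
    [IsProbabilityMeasure P] {Z : Ω → ℝ} {K : ℝ≥0} (hK : 1 ≤ K) (h : HasSubgaussianMGF Z K P)
    (hvar : ∫ ω, Z ω ^ 2 ∂P = 1) {s : ℝ} (hs : |s| ≤ (8 * (K : ℝ))⁻¹) :
    Integrable (fun ω => Real.exp (s * (Z ω ^ 2 - 1))) P ∧
      mgf (fun ω => Z ω ^ 2 - 1) P s ≤ Real.exp (256 * (K : ℝ) ^ 2 * s ^ 2) := by
  have hK0 : 0 < K := one_pos.trans_le hK
  have hK' : (1 : ℝ) ≤ K := hK
  have hZ := h.aemeasurable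
  have hZ2 : Integrable (fun ω => Z ω ^ 2) P := (h.memLp 2).integrable_sq
  have hZ1 : Integrable (fun ω => 1 + s * (Z ω ^ 2 - 1)) P :=
    (integrable_const _).add ((hZ2.sub (integrable_const _)).const_mul _)
  have hexp := (h.integrable_exp_sq hK0).const_mul
    (s ^ 2 * (128 * (K : ℝ) ^ 2) * Real.exp (4 * (K : ℝ))⁻¹)
  have hb := fun ω => Real.exp_mul_sq_sub_one_le (z := Z ω) (by positivity) hs
  have hm : AEMeasurable (fun ω => Real.exp (s * (Z ω ^ 2 - 1))) P := by fun_prop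
  have hint : Integrable (fun ω => Real.exp (s * (Z ω ^ 2 - 1))) P := by
    refine (hZ1.add hexp).mono' hm.aestronglyMeasurable ?_
    filter_upwards with ω
    rw [Real.norm_of_nonneg (by positivity)]
    exact hb ω
  refine ⟨hint, ?_⟩
  -- This is where `K ≥ 1` enters: `exp(1/(4K)) ≤ exp(1/4) ≤ √2`.
  have hconst : Real.exp (4 * (K : ℝ))⁻¹ * Real.sqrt 2 ≤ 2 := by
    have h1 : Real.exp (4 * (K : ℝ))⁻¹ ≤ Real.sqrt 2 := by
      refine Real.le_sqrt_of_sq_le ?_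
      rw [← Real.exp_nat_mul]
      have : ((2 : ℕ) : ℝ) * (4 * (K : ℝ))⁻¹ ≤ Real.log 2 := by
        have : (4 * (K : ℝ))⁻¹ ≤ 4⁻¹ := by gcongr; linarith
        have := Real.log_two_gt_d9
        push_cast
        linarith
      calc _ ≤ Real.exp (Real.log 2) := by gcongr
        _ = 2 := Real.exp_log (by norm_num)
    calc _ ≤ Real.sqrt 2 * Real.sqrt 2 := by gcongr
      _ = 2 := Real.mul_self_sqrt (by norm_num)
  calc mgf (fun ω => Z ω ^ 2 - 1) P s
      ≤ ∫ ω, (1 + s * (Z ω ^ 2 - 1)) + s ^ 2 * (128 * (K : ℝ) ^ 2) * Real.exp (4 * (K : ℝ))⁻¹ *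
          Real.exp ((4 * (K : ℝ))⁻¹ * Z ω ^ 2) ∂P := integral_mono hint (hZ1.add hexp) hb
    _ = 1 + s ^ 2 * (128 * (K : ℝ) ^ 2) * Real.exp (4 * (K : ℝ))⁻¹ *
          ∫ ω, Real.exp ((4 * (K : ℝ))⁻¹ * Z ω ^ 2) ∂P := by
        rw [integral_add hZ1 hexp, integral_const_mul,
          integral_add (f := fun _ => (1 : ℝ)) (g := fun ω => s * (Z ω ^ 2 - 1))
            (integrable_const _) ((hZ2.sub (integrable_const _)).const_mul _),
          integral_const_mul, integral_sub hZ2 (integrable_const _), hvar]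
        simp
    _ ≤ 1 + s ^ 2 * (128 * (K : ℝ) ^ 2) * Real.exp (4 * (K : ℝ))⁻¹ * Real.sqrt 2 := by
        gcongr; exact h.integral_exp_sq_le hK0
    _ = 1 + s ^ 2 * (128 * (K : ℝ) ^ 2) * (Real.exp (4 * (K : ℝ))⁻¹ * Real.sqrt 2) := by ring
    _ ≤ 1 + s ^ 2 * (128 * (K : ℝ) ^ 2) * 2 := by gcongr
    _ = 256 * (K : ℝ) ^ 2 * s ^ 2 + 1 := by ring
    _ ≤ _ := Real.add_one_le_exp _

/-- **Bernstein's inequality** for sums of squares of independent normalized sub-Gaussian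
variables. -/
lemma measure_sum_sq_deviation_le [IsProbabilityMeasure P] {ι : Type*} [Fintype ι]
    {Z : ι → Ω → ℝ} {K : ℝ≥0} (hK : 1 ≤ K) (hind : iIndepFun Z P)
    (hZ : ∀ j, HasSubgaussianMGF (Z j) K P) (hvar : ∀ j, ∫ ω, Z j ω ^ 2 ∂P = 1)
    {ε : ℝ} (hε : 0 < ε) (hε1 : ε < 1) :
    P.real {ω | Fintype.card ι * ε ≤ |∑ j, (Z j ω ^ 2 - 1)|} ≤
      2 * Real.exp (-(Fintype.card ι * ε ^ 2 / (1024 * (K : ℝ) ^ 2))) := by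
  have hK' : (1 : ℝ) ≤ K := hK
  have hm : ∀ j, AEMeasurable (fun ω => Z j ω ^ 2 - 1) P := fun j => by
    have := (hZ j).aemeasurable; fun_prop
  have hind' : iIndepFun (fun j ω => Z j ω ^ 2 - 1) P :=
    hind.comp (fun _ x => x ^ 2 - 1) (fun _ => by fun_prop)
  -- The minimizer of the Chernoff exponent `-sε + 256K²s²`; `ε < 1 ≤ K` keeps it in the admissible
  -- range.
  set s : ℝ := ε / (512 * (K : ℝ) ^ 2) with hs
  have hs0 : 0 < s := by positivity
  have hs8 : s ≤ (8 * (K : ℝ))⁻¹ := by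
    rw [hs, div_le_iff₀ (by positivity)]
    have : (8 * (K : ℝ))⁻¹ * (512 * (K : ℝ) ^ 2) = 64 * K := by field_simp; norm_num
    rw [this]; linarith
  have hsum : (fun ω => ∑ j, (Z j ω ^ 2 - 1)) = ∑ j, fun ω => Z j ω ^ 2 - 1 := by
    ext ω; simp
  have hmgf : ∀ t : ℝ, |t| ≤ (8 * (K : ℝ))⁻¹ →
      mgf (fun ω => ∑ j, (Z j ω ^ 2 - 1)) P t ≤
        Real.exp (Fintype.card ι * (256 * (K : ℝ) ^ 2 * t ^ 2)) := by
    intro t ht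
    rw [hsum, hind'.mgf_sum₀ hm, Real.exp_nat_mul]
    refine (Finset.prod_le_prod (fun _ _ => mgf_nonneg) fun j _ =>
      ((hZ j).integrable_and_mgf_sq_sub_one_le hK (hvar j) ht).2).trans_eq ?_
    rw [Finset.prod_const, Finset.card_univ]
  have hint : ∀ t : ℝ, |t| ≤ (8 * (K : ℝ))⁻¹ →
      Integrable (fun ω => Real.exp (t * ∑ j, (Z j ω ^ 2 - 1))) P := by
    intro t ht
    have hmm : ∀ j, Measurable ((hm j).mk) := fun j => (hm j).measurable_mk
    have := (hind'.congr fun j => (hm j).ae_eq_mk).integrable_exp_mul_sum (t := t)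
      (s := Finset.univ) hmm fun j _ =>
        ((hZ j).integrable_and_mgf_sq_sub_one_le hK (hvar j) ht).1.congr (by
          filter_upwards [(hm j).ae_eq_mk] with ω hω using by rw [← hω])
    refine this.congr ?_
    filter_upwards [ae_all_iff.2 fun j => (hm j).ae_eq_mk] with ω hω
    simp [Finset.sum_apply, ← hω]
  have hexp : Real.exp (-s * (Fintype.card ι * ε)) *
      Real.exp (Fintype.card ι * (256 * (K : ℝ) ^ 2 * s ^ 2)) =
        Real.exp (-(Fintype.card ι * ε ^ 2 / (1024 * (K : ℝ) ^ 2))) := by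
    rw [← Real.exp_add, hs]
    congr 1
    field_simp
    ring
  have habs : |s| ≤ (8 * (K : ℝ))⁻¹ := by rwa [abs_of_pos hs0]
  have habs' : |-s| ≤ (8 * (K : ℝ))⁻¹ := by rwa [abs_neg]
  have hup := (measure_ge_le_exp_mul_mgf (Fintype.card ι * ε) hs0.le (hint s habs)).trans
    (mul_le_mul_of_nonneg_left (hmgf s habs) (Real.exp_pos _).le)
  have hlo := (measure_le_le_exp_mul_mgf (-(Fintype.card ι * ε)) (neg_nonpos.2 hs0.le)
    (hint (-s) habs')).trans (mul_le_mul_of_nonneg_left (hmgf (-s) habs') (Real.exp_pos _).le)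
  rw [hexp] at hup
  rw [neg_neg, mul_neg, ← neg_mul s, neg_sq, hexp] at hlo
  calc _ ≤ P.real ({ω | Fintype.card ι * ε ≤ ∑ j, (Z j ω ^ 2 - 1)} ∪
        {ω | ∑ j, (Z j ω ^ 2 - 1) ≤ -(Fintype.card ι * ε)}) := by
        refine measureReal_mono fun ω hω => ?_
        simp only [Set.mem_ofPred_eq, Set.mem_union] at hω ⊢
        rcases le_abs.1 hω with h | h
        · exact Or.inl h
        · exact Or.inr (by linarith)
    _ ≤ _ := measureReal_union_le _ _
    _ ≤ _ := by linarith

end Subgaussian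

section MatrixImage

variable {d k : ℕ}

lemma transposeApply_apply (M : Matrix (Fin d) (Fin k) ℝ) (v : EuclideanSpace ℝ (Fin d))
    (j : Fin k) : transposeApply M v j = ∑ i, M i j * v i := by
  simp [transposeApply, Matrix.mulVec, dotProduct]

/-- `transposeApply M` as a linear map. -/
noncomputable def transposeLinearMap (M : Matrix (Fin d) (Fin k) ℝ) :
    EuclideanSpace ℝ (Fin d) →ₗ[ℝ] EuclideanSpace ℝ (Fin k) where
  toFun := transposeApply M
  map_add' v w := by simp [transposeApply, Matrix.mulVec_add]
  map_smul' c v := by simp [transposeApply, Matrix.mulVec_smul]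

lemma transposeApply_smul (M : Matrix (Fin d) (Fin k) ℝ) (c : ℝ) (v : EuclideanSpace ℝ (Fin d)) :
    transposeApply M (c • v) = c • transposeApply M v := (transposeLinearMap M).map_smul c v

end MatrixImage

/-! ### Concentration for one vector and for finitely many -/

section SingleVector

variable {Ω : Type*} [MeasurableSpace Ω] {P : Measure Ω} {d k : ℕ}
  {R : Ω → Matrix (Fin d) (Fin k) ℝ} {K : ℝ≥0}

lemma HasIIDSubgaussianEntries.mono {K' : ℝ≥0} (h : HasIIDSubgaussianEntries P R K)
    (hK : K ≤ K') : HasIIDSubgaussianEntries P R K' :=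
  ⟨h.indep, h.identDistrib, h.mean_eq_zero, h.variance_eq, fun i j => (h.subgaussian i j).mono hK⟩

lemma HasIIDSubgaussianEntries.aemeasurable (h : HasIIDSubgaussianEntries P R K)
    (i : Fin d) (j : Fin k) : AEMeasurable (fun ω => R ω i j) P :=
  (h.identDistrib (i, j) (i, j)).aemeasurable_fst

lemma HasIIDSubgaussianEntries.iIndepFun_column (h : HasIIDSubgaussianEntries P R K) (j : Fin k) :
    iIndepFun (fun i ω => R ω i j) P :=
  h.indep.precomp (g := fun i : Fin d => (i, j)) fun _ _ h => (Prod.mk.inj h).1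

lemma HasIIDSubgaussianEntries.iIndepFun_coord (h : HasIIDSubgaussianEntries P R K)
    (u : EuclideanSpace ℝ (Fin d)) :
    iIndepFun (fun j ω => Real.sqrt k * transposeApply (R ω) u j) P := by
  -- Coordinate `j` involves only column `j`, so the indices are swapped to make the columns the
  -- independent blocks.
  have h1 : iIndepFun (fun p : Fin k × Fin d => fun ω => R ω p.2 p.1) P :=
    h.indep.precomp (g := Prod.swap) Prod.swap_injective
  have h2 := iIndepFun_curry (X := fun j i ω => R ω i j) (fun j i => h.aemeasurable i j) h1
  have h3 := h2.comp (fun _ x => Real.sqrt k * ∑ i, x i * u i) (fun _ => by fun_prop)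
  simp_rw [transposeApply_apply]
  exact h3

lemma HasIIDSubgaussianEntries.hasSubgaussianMGF_coord (h : HasIIDSubgaussianEntries P R K)
    {u : EuclideanSpace ℝ (Fin d)} (hu : ‖u‖ = 1) (j : Fin k) :
    HasSubgaussianMGF (fun ω => Real.sqrt k * transposeApply (R ω) u j) K P := by
  have hind : iIndepFun (fun i ω => u i * (Real.sqrt k * R ω i j)) P :=
    (h.iIndepFun_column j).comp (fun i x => u i * (Real.sqrt k * x)) (fun _ => by fun_prop)
  have hs := HasSubgaussianMGF.sum_of_iIndepFun hind (s := Finset.univ)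
    fun i _ => (h.subgaussian i j).const_mul (u i)
  have h1 : (fun ω => ∑ i, u i * (Real.sqrt k * R ω i j)) =
      fun ω => Real.sqrt k * transposeApply (R ω) u j := by
    ext ω
    rw [transposeApply_apply, Finset.mul_sum]
    exact Finset.sum_congr rfl fun i _ => by ring
  rw [h1] at hs
  have h2 : ∑ i, u i ^ 2 = 1 := by
    rw [← EuclideanSpace.real_norm_sq_eq, hu, one_pow]
  have h3 : ∑ i, (NNReal.mk (u i ^ 2) (sq_nonneg _)) * K = K := by
    rw [← Finset.sum_mul]
    ext
    push_cast
    rw [h2, one_mul]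
  exact hs.mono h3.le

variable [IsProbabilityMeasure P]

/-- `variance` takes the default value 0 outside L², so the value `1/k ≠ 0` forces square
integrability. -/
lemma HasIIDSubgaussianEntries.memLp (h : HasIIDSubgaussianEntries P R K) (hk : 0 < k)
    (i : Fin d) (j : Fin k) : MemLp (fun ω => R ω i j) 2 P := by
  refine (memLp_two_of_variance_ne_zero (h.aemeasurable i j).aestronglyMeasurable ?_)
  rw [h.variance_eq]
  positivity

lemma HasIIDSubgaussianEntries.integral_sq_coord (h : HasIIDSubgaussianEntries P R K)
    (hk : 0 < k) {u : EuclideanSpace ℝ (Fin d)} (hu : ‖u‖ = 1) (j : Fin k) :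
    ∫ ω, (Real.sqrt k * transposeApply (R ω) u j) ^ 2 ∂P = 1 := by
  have hind : iIndepFun (fun i ω => R ω i j * u i) P :=
    (h.iIndepFun_column j).comp (fun i x => x * u i) (fun _ => by fun_prop)
  have hL : ∀ i, MemLp (fun ω => R ω i j * u i) 2 P := fun i => (h.memLp hk i j).mul_const _
  have h1 : (fun ω => transposeApply (R ω) u j) = ∑ i, fun ω => R ω i j * u i := by
    ext ω
    rw [transposeApply_apply, Finset.sum_apply]
  have hvar : variance (fun ω => transposeApply (R ω) u j) P = 1 / k := by
    rw [h1, IndepFun.variance_sum (fun i _ => hL i)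
      (fun i _ i' _ hii => hind.indepFun hii)]
    simp_rw [variance_mul_const, h.variance_eq]
    rw [← Finset.mul_sum, ← EuclideanSpace.real_norm_sq_eq, hu]
    simp
  have hmean : ∫ ω, transposeApply (R ω) u j ∂P = 0 := by
    simp_rw [transposeApply_apply]
    rw [integral_finsetSum _ fun i _ => (hL i).integrable (by norm_num)]
    simp [integral_mul_const, h.mean_eq_zero]
  have hm : AEMeasurable (fun ω => transposeApply (R ω) u j) P := by
    simp_rw [transposeApply_apply]
    have := fun i => h.aemeasurable i j
    fun_prop
  rw [variance_of_integral_eq_zero hm hmean] at hvar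
  simp_rw [mul_pow, Real.sq_sqrt (Nat.cast_nonneg k)]
  rw [integral_const_mul, hvar]
  field_simp

/-- The squared norm of a fixed vector is preserved with high probability. -/
lemma HasIIDSubgaussianEntries.measure_norm_sq_deviation_le (h : HasIIDSubgaussianEntries P R K)
    (hK : 1 ≤ K) (hk : 0 < k) (v : EuclideanSpace ℝ (Fin d)) {ε : ℝ} (hε : 0 < ε) (hε1 : ε < 1) :
    P.real {ω | ¬ |‖transposeApply (R ω) v‖ ^ 2 - ‖v‖ ^ 2| ≤ ε * ‖v‖ ^ 2} ≤
      2 * Real.exp (-(k * ε ^ 2 / (1024 * (K : ℝ) ^ 2))) := by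
  rcases eq_or_ne v 0 with rfl | hv
  · have h0 : ∀ ω, transposeApply (R ω) 0 = 0 := fun ω => (transposeLinearMap (R ω)).map_zero
    simp only [h0]
    simp
    positivity
  set u := ‖v‖⁻¹ • v with hu
  have hv0 : 0 < ‖v‖ := norm_pos_iff.2 hv
  have hu1 : ‖u‖ = 1 := norm_smul_inv_norm (𝕜 := ℝ) hv
  have hvu : v = ‖v‖ • u := by rw [hu, smul_smul, mul_inv_cancel₀ hv0.ne', one_smul]
  have hb := measure_sum_sq_deviation_le hK (h.iIndepFun_coord u)
    (h.hasSubgaussianMGF_coord hu1) (h.integral_sq_coord hk hu1) hε hε1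
  rw [Fintype.card_fin] at hb
  refine (measureReal_mono fun ω hω => ?_).trans hb
  simp only [Set.mem_ofPred_eq, not_le] at hω ⊢
  have hk' : (0 : ℝ) < k := Nat.cast_pos.2 hk
  have h1 : ∑ j, ((Real.sqrt k * transposeApply (R ω) u j) ^ 2 - 1) =
      k * (‖transposeApply (R ω) u‖ ^ 2 - 1) := by
    rw [EuclideanSpace.real_norm_sq_eq, Finset.sum_sub_distrib]
    simp_rw [mul_pow, Real.sq_sqrt hk'.le]
    rw [← Finset.mul_sum]
    simp
    ring
  have h2 : ‖transposeApply (R ω) v‖ ^ 2 = ‖v‖ ^ 2 * ‖transposeApply (R ω) u‖ ^ 2 := by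
    conv_lhs => rw [hvu, transposeApply_smul, norm_smul, mul_pow, norm_norm]
  rw [h1, abs_mul, abs_of_pos hk']
  rw [h2, ← mul_sub_one, abs_mul, abs_of_pos (by positivity), mul_comm] at hω
  have := lt_of_mul_lt_mul_left hω (sq_nonneg ‖v‖)
  gcongr

/-- Subadditivity suffices, so the events need not be measurable. -/
lemma one_sub_measureReal_compl_le (s : Set Ω) : 1 - P.real sᶜ ≤ P.real s := by
  have := measureReal_union_le (μ := P) s sᶜ
  rw [Set.union_compl_self, probReal_univ] at this
  linarith

lemma HasIIDSubgaussianEntries.measure_forall_norm_sq_deviation_le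
    (h : HasIIDSubgaussianEntries P R K) (hK : 1 ≤ K) (hk : 0 < k) {ι : Type*} [Fintype ι]
    (v : ι → EuclideanSpace ℝ (Fin d)) {ε : ℝ} (hε : 0 < ε) (hε1 : ε < 1) :
    P.real {ω | ∀ i, |‖transposeApply (R ω) (v i)‖ ^ 2 - ‖v i‖ ^ 2| ≤ ε * ‖v i‖ ^ 2}ᶜ ≤
      Fintype.card ι * (2 * Real.exp (-(k * ε ^ 2 / (1024 * (K : ℝ) ^ 2)))) := by
  have h1 : {ω | ∀ i, |‖transposeApply (R ω) (v i)‖ ^ 2 - ‖v i‖ ^ 2| ≤ ε * ‖v i‖ ^ 2}ᶜ =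
      ⋃ i, {ω | ¬ |‖transposeApply (R ω) (v i)‖ ^ 2 - ‖v i‖ ^ 2| ≤ ε * ‖v i‖ ^ 2} := by
    ext ω; simp
  rw [h1]
  refine (measureReal_iUnion_fintype_le _).trans ?_
  refine (Finset.sum_le_sum fun i _ => h.measure_norm_sq_deviation_le hK hk (v i) hε hε1).trans ?_
  simp

end SingleVector

/-! ### Nets of the unit sphere -/

section Net

open Module

variable {E : Type*} [NormedAddCommGroup E] [NormedSpace ℝ E] [FiniteDimensional ℝ E]

/-- A half-net of the unit sphere of cardinality at most `5 ^ dim E`. -/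
lemma exists_half_net_sphere : ∃ N : Finset E, N.card ≤ 5 ^ finrank ℝ E ∧ (∀ x ∈ N, ‖x‖ = 1) ∧
    ∀ x : E, ‖x‖ = 1 → ∃ y ∈ N, ‖x - y‖ ≤ 1 / 2 := by
  classical
  let S : Finset E → Prop := fun N => (∀ x ∈ N, ‖x‖ = 1) ∧
    ∀ x ∈ N, ∀ y ∈ N, x ≠ y → 1 / 2 ≤ ‖x - y‖
  have hcard : ∀ N, S N → N.card ≤ 5 ^ finrank ℝ E := by
    intro N hN
    -- Doubling turns separation 1/2 on the unit sphere into separation 1 inside the ball of radius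
    -- 2, the setting of `Besicovitch.card_le_of_separated`.
    have hinj : Function.Injective fun x : E => (2 : ℝ) • x := smul_right_injective E two_ne_zero
    rw [← Finset.card_image_of_injective N hinj]
    refine Besicovitch.card_le_of_separated _ ?_ ?_
    · intro c hc
      obtain ⟨x, hx, rfl⟩ := Finset.mem_image.1 hc
      simp [norm_smul, hN.1 x hx]
    · intro c hc c' hc' hne
      obtain ⟨x, hx, rfl⟩ := Finset.mem_image.1 hc
      obtain ⟨y, hy, rfl⟩ := Finset.mem_image.1 hc'
      have := hN.2 x hx y hy fun h => hne (by rw [h])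
      rw [← smul_sub, norm_smul, Real.norm_of_nonneg zero_le_two]
      linarith
  -- A separated set of largest cardinality is a net: a point far from all of it could be added.
  let p : ℕ → Prop := fun n => ∃ N, S N ∧ N.card = n
  have hp0 : p 0 := ⟨∅, ⟨by simp, by simp⟩, rfl⟩
  have hg := Nat.findGreatest_spec (P := p) (Nat.zero_le (5 ^ finrank ℝ E)) hp0
  obtain ⟨N, hN, hNc⟩ := hg
  refine ⟨N, hcard N hN, hN.1, fun x hx => ?_⟩
  by_contra! hcon
  have hxN : x ∉ N := fun h => by
    have := hcon x h
    simp at this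
    linarith
  have hS : S (insert x N) := by
    refine ⟨fun y hy => ?_, fun y hy z hz hyz => ?_⟩
    · rcases Finset.mem_insert.1 hy with rfl | hy
      exacts [hx, hN.1 y hy]
    · rcases Finset.mem_insert.1 hy with hy | hy <;> rcases Finset.mem_insert.1 hz with hz | hz
      · exact absurd (hy.trans hz.symm) hyz
      · rw [hy]; exact (hcon z hz).le
      · rw [hz, norm_sub_rev]; exact (hcon y hy).le
      · exact hN.2 y hy z hz hyz
  have := Nat.le_findGreatest (P := p) (hcard _ hS) ⟨_, hS, rfl⟩
  rw [Finset.card_insert_of_notMem hxN] at this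
  omega

omit [FiniteDimensional ℝ E] in
-- Moving a unit vector to the net costs at most `‖T‖/2`, which is absorbed on the left since `‖T‖`
-- is finite.
lemma ContinuousLinearMap.opNorm_le_of_half_net {F : Type*} [NormedAddCommGroup F]
    [NormedSpace ℝ F] (T : E →L[ℝ] F) {N : Set E} {M : ℝ} (hM : 0 ≤ M)
    (hN : ∀ x : E, ‖x‖ = 1 → ∃ y ∈ N, ‖x - y‖ ≤ 1 / 2) (hT : ∀ y ∈ N, ‖T y‖ ≤ M) :
    ‖T‖ ≤ 2 * M := by
  have h : ‖T‖ ≤ M + ‖T‖ / 2 := by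
    refine T.opNorm_le_of_unit_norm (by positivity) fun x hx => ?_
    obtain ⟨y, hy, hxy⟩ := hN x hx
    calc ‖T x‖ = ‖T y + T (x - y)‖ := by rw [← map_add]; simp
      _ ≤ ‖T y‖ + ‖T (x - y)‖ := norm_add_le _ _
      _ ≤ M + ‖T‖ * (1 / 2) := add_le_add (hT y hy) (T.le_opNorm_of_le hxy)
      _ = _ := by ring
  linarith

end Net

/-! ### From a net to all vectors, and to subspaces -/

section Restricted

variable {E F : Type*} [NormedAddCommGroup E] [InnerProductSpace ℝ E] [FiniteDimensional ℝ E]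
  [NormedAddCommGroup F] [InnerProductSpace ℝ F] [FiniteDimensional ℝ F]

/-- Control of the quadratic form `‖L x‖² - ‖x‖²` on sums and differences of points of a half-net
yields control everywhere. -/
lemma abs_norm_sq_sub_le_of_half_net (L : E →ₗ[ℝ] F) {N : Set E} {ε : ℝ} (hε : 0 ≤ ε)
    (hN1 : ∀ x ∈ N, ‖x‖ = 1) (hN : ∀ x : E, ‖x‖ = 1 → ∃ y ∈ N, ‖x - y‖ ≤ 1 / 2)
    (hadd : ∀ x ∈ N, ∀ y ∈ N, |‖L (x + y)‖ ^ 2 - ‖x + y‖ ^ 2| ≤ ε * ‖x + y‖ ^ 2)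
    (hsub : ∀ x ∈ N, ∀ y ∈ N, |‖L (x - y)‖ ^ 2 - ‖x - y‖ ^ 2| ≤ ε * ‖x - y‖ ^ 2) (v : E) :
    |‖L v‖ ^ 2 - ‖v‖ ^ 2| ≤ 4 * ε * ‖v‖ ^ 2 := by
  let A : E →L[ℝ] F := L.toContinuousLinearMap
  let T : E →L[ℝ] E := (ContinuousLinearMap.adjoint A).comp A - ContinuousLinearMap.id ℝ E
  have hT : ∀ x y, inner ℝ (T x) y = inner ℝ (L x) (L y) - inner ℝ x y := by
    intro x y
    simp [T, A, inner_sub_left, ContinuousLinearMap.adjoint_inner_left]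
  -- Polarization: `4⟨Tx, y⟩` is the difference of the quadratic forms at `x + y` and `x - y`, and
  -- `‖x + y‖² + ‖x - y‖² = 4`.
  have hxy : ∀ x ∈ N, ∀ y ∈ N, |inner ℝ (T x) y| ≤ ε := by
    intro x hx y hy
    have h1 := hadd x hx y hy
    have h2 := hsub x hx y hy
    have h3 := norm_add_sq_real x y
    have h4 := norm_sub_sq_real x y
    rw [hN1 x hx, hN1 y hy] at h3 h4
    rw [map_add, norm_add_sq_real] at h1
    rw [map_sub, norm_sub_sq_real] at h2
    rw [hT]
    rw [abs_le] at h1 h2 ⊢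
    constructor <;> nlinarith
  have hnorm : ‖T‖ ≤ 4 * ε := by
    -- The net is used twice, for the functional `⟨Tx, ·⟩` and then for `T`; each use costs a factor
    -- 2.
    have := T.opNorm_le_of_half_net (M := 2 * ε) (by positivity) hN fun x hx => by
      rw [← innerSL_apply_norm ℝ (T x)]
      exact (innerSL ℝ (T x)).opNorm_le_of_half_net hε hN fun y hy => hxy x hx y hy
    linarith
  rw [← real_inner_self_eq_norm_sq, ← real_inner_self_eq_norm_sq, ← hT]
  calc |inner ℝ (T v) v| ≤ ‖T v‖ * ‖v‖ := abs_real_inner_le_norm _ _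
    _ ≤ (4 * ε * ‖v‖) * ‖v‖ := by gcongr; exact T.le_of_opNorm_le hnorm v
    _ = _ := by rw [real_inner_self_eq_norm_sq]; ring

end Restricted

section Subspace

variable {Ω : Type*} [MeasurableSpace Ω] {P : Measure Ω} [IsProbabilityMeasure P] {d k : ℕ}
  {R : Ω → Matrix (Fin d) (Fin k) ℝ} {K : ℝ≥0}

lemma HasIIDSubgaussianEntries.measure_subspace_deviation_le (h : HasIIDSubgaussianEntries P R K)
    (hK : 1 ≤ K) (hk : 0 < k) (V : Submodule ℝ (EuclideanSpace ℝ (Fin d))) {ε : ℝ} (hε : 0 < ε)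
    (hε1 : ε < 1) :
    P.real {ω | ∀ v ∈ V, |‖transposeApply (R ω) v‖ ^ 2 - ‖v‖ ^ 2| ≤ ε * ‖v‖ ^ 2}ᶜ ≤
      4 * 25 ^ Module.finrank ℝ V * Real.exp (-(k * ε ^ 2 / (16384 * (K : ℝ) ^ 2))) := by
  obtain ⟨N, hcard, hN1, hN⟩ := exists_half_net_sphere (E := V)
  let w : (N × N) × Bool → EuclideanSpace ℝ (Fin d) := fun p =>
    if p.2 then ((p.1.1 + p.1.2 : V) : EuclideanSpace ℝ (Fin d)) else ((p.1.1 - p.1.2 : V) : _)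
  -- Accuracy `ε/4` offsets the net's loss of 4, whence `16384 = 16 · 1024`.
  have hb := h.measure_forall_norm_sq_deviation_le hK hk w (ε := ε / 4) (by positivity)
    (by linarith)
  refine (measureReal_mono (Set.compl_subset_compl.2 fun ω hω => ?_)).trans (hb.trans ?_)
  · simp only [Set.mem_ofPred_eq] at hω ⊢
    intro v hv
    have := abs_norm_sq_sub_le_of_half_net ((transposeLinearMap (R ω)).comp V.subtype)
      (N := (N : Set V)) (ε := ε / 4) (by positivity) hN1 hN
      (fun x hx y hy => hω ((⟨x, hx⟩, ⟨y, hy⟩), true))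
      (fun x hx y hy => hω ((⟨x, hx⟩, ⟨y, hy⟩), false)) ⟨v, hv⟩
    rw [mul_div_cancel₀ _ (by norm_num : (4 : ℝ) ≠ 0)] at this
    exact this
  · have h1 : ((Fintype.card ((N × N) × Bool) : ℕ) : ℝ) ≤ 2 * 25 ^ Module.finrank ℝ V := by
      simp only [Fintype.card_prod, Fintype.card_coe, Fintype.card_bool]
      have : (N.card : ℝ) ≤ 5 ^ Module.finrank ℝ V := by exact_mod_cast hcard
      have h25 : (25 : ℝ) ^ Module.finrank ℝ V =
          5 ^ Module.finrank ℝ V * 5 ^ Module.finrank ℝ V := by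
        rw [← mul_pow]; norm_num
      push_cast
      rw [h25, mul_comm]
      gcongr
    have h2 : k * (ε / 4) ^ 2 / (1024 * (K : ℝ) ^ 2) = k * ε ^ 2 / (16384 * (K : ℝ) ^ 2) := by
      have : (0 : ℝ) < K := one_pos.trans_le hK
      field_simp
      norm_num
    rw [h2]
    calc _ ≤ 2 * 25 ^ Module.finrank ℝ V *
          (2 * Real.exp (-(k * ε ^ 2 / (16384 * (K : ℝ) ^ 2)))) := by gcongr
      _ = _ := by ring

end Subspace

/-! ### Numerical tail estimates -/

section Constants

lemma four_mul_exp_neg_le {x y t : ℝ} (hxy : Real.log 4 + x + t ≤ y) :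
    4 * Real.exp x * Real.exp (-y) ≤ Real.exp (-t) := by
  calc 4 * Real.exp x * Real.exp (-y) = Real.exp (Real.log 4 + x - y) := by
        rw [Real.exp_sub, Real.exp_add, Real.exp_log (by norm_num), Real.exp_neg]; ring
    _ ≤ _ := by gcongr; linarith

lemma log_four_eq : Real.log 4 = 2 * Real.log 2 := by
  rw [show (4 : ℝ) = 2 ^ 2 by norm_num, Real.log_pow]; norm_num

lemma log_twentyFive_le : Real.log 25 ≤ 5 * Real.log 2 := by
  calc Real.log 25 ≤ Real.log (2 ^ 5) := Real.log_le_log (by norm_num) (by norm_num)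
    _ = _ := by rw [Real.log_pow]; norm_num

lemma twentyFive_pow_eq_exp (r : ℕ) : (25 : ℝ) ^ r = Real.exp (r * Real.log 25) := by
  rw [Real.exp_nat_mul, Real.exp_log (by norm_num)]

/-- Tail estimate for the restricted isometry property when `ε ≤ 1 / 2`. -/
lemma restrictedIsometry_tail_le_of_le_half {A k M ε : ℝ} {r : ℕ} (hA : 0 < A) (hM1 : 1 ≤ M)
    (hrM : r ≤ M) (hε : 0 < ε) (hε2 : ε ≤ 1 / 2)
    (hk : 32 * A * ((ε ^ 2)⁻¹ * Real.log ε⁻¹ * M) ≤ k) :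
    4 * 25 ^ r * Real.exp (-(k * ε ^ 2 / A)) ≤ Real.exp (-(Real.log ε⁻¹ * M)) := by
  have hL : Real.log 2 ≤ Real.log ε⁻¹ := by
    refine Real.log_le_log (by norm_num) ?_
    rw [le_inv_comm₀ (by norm_num) hε]
    linarith
  have hlog2 : 0 < Real.log 2 := Real.log_pos (by norm_num)
  have h1 : 32 * (Real.log ε⁻¹ * M) ≤ k * ε ^ 2 / A := by
    rw [le_div_iff₀ hA]
    calc 32 * (Real.log ε⁻¹ * M) * A
        = 32 * A * ((ε ^ 2)⁻¹ * Real.log ε⁻¹ * M) * ε ^ 2 := by field_simp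
      _ ≤ _ := by gcongr
  have h2 : Real.log 2 ≤ Real.log ε⁻¹ * M := by nlinarith
  have h3 : r * Real.log 25 ≤ 5 * (Real.log ε⁻¹ * M) := by
    calc r * Real.log 25 ≤ M * (5 * Real.log ε⁻¹) := by
          gcongr
          exact log_twentyFive_le.trans (by linarith)
      _ = _ := by ring
  rw [twentyFive_pow_eq_exp]
  -- In units of `M log ε⁻¹`, the cost is 2 for `log 4`, 5 for `r log 25` and 1 for the target, out
  -- of 32 available.
  refine four_mul_exp_neg_le ?_
  rw [log_four_eq]
  linarith

/-- Tail estimate for the restricted isometry property when `1 / 2 ≤ ε`. -/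
lemma restrictedIsometry_tail_le_of_half_le {A k M ε Q : ℝ} {r : ℕ} (hA : 0 < A) (hr : 1 ≤ r)
    (hε2 : 1 / 2 ≤ ε) (hε1 : ε < 1) (hM : 0 ≤ M) (hMQ : Real.log 2 * M ≤ Q)
    (hrQ : Real.log 2 * r ≤ Q) (hk : 32 * A * Q ≤ k) :
    4 * 25 ^ r * Real.exp (-(k * (1 / 2) ^ 2 / A)) ≤ Real.exp (-(Real.log ε⁻¹ * M)) := by
  have hL : Real.log ε⁻¹ ≤ Real.log 2 := by
    refine Real.log_le_log (by positivity) ?_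
    rw [inv_le_comm₀ (by linarith) (by norm_num)]
    linarith
  have hlog2 : 0 < Real.log 2 := Real.log_pos (by norm_num)
  -- The origin of 32: `32 · (1/2)² = 8 = 2 + 5 + 1`, the same costs in units of `Q`.
  have h1 : 8 * Q ≤ k * (1 / 2) ^ 2 / A := by
    rw [le_div_iff₀ hA]
    linarith
  have h2 : Real.log 2 ≤ Q := by
    have : (1 : ℝ) ≤ r := by exact_mod_cast hr
    nlinarith
  have h3 : r * Real.log 25 ≤ 5 * Q := by
    calc r * Real.log 25 ≤ r * (5 * Real.log 2) := by gcongr; exact log_twentyFive_le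
      _ = 5 * (Real.log 2 * r) := by ring
      _ ≤ _ := by gcongr
  have h4 : Real.log ε⁻¹ * M ≤ Q := (mul_le_mul_of_nonneg_right hL hM).trans hMQ
  rw [twentyFive_pow_eq_exp]
  refine four_mul_exp_neg_le ?_
  rw [log_four_eq]
  linarith

end Constants

/-! ### The two properties and the theorem -/

section Main

variable {Ω : Type*} [MeasurableSpace Ω] {P : Measure Ω} [IsProbabilityMeasure P] {d k n r : ℕ}
  {R : Ω → Matrix (Fin d) (Fin k) ℝ} {K : ℝ≥0}

lemma HasIIDSubgaussianEntries.isJLT (h : HasIIDSubgaussianEntries P R K) (hK : 1 ≤ K)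
    (hk : 0 < k) (hnr : 2 ≤ n * r) {ε : ℝ} (hε : 0 < ε) (hε1 : ε < 1)
    (hkC : 524288 * (K : ℝ) ^ 2 * ((ε ^ 2)⁻¹ * r * Real.log (n * r)) ≤ k) :
    IsJLT P R (2 * n * r) (ε / Real.sqrt r) (Real.exp (-Real.log (n * r))) := by
  have hr : 0 < r := Nat.pos_of_mul_pos_left (a := n) (by omega)
  have hr1 : (1 : ℝ) ≤ r := by exact_mod_cast hr
  have hs1 : 1 ≤ Real.sqrt r := Real.one_le_sqrt.2 hr1
  have hnr' : (2 : ℝ) ≤ n * r := by exact_mod_cast hnr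
  have hlog : Real.log 2 ≤ Real.log (n * r) := Real.log_le_log (by norm_num) hnr'
  have hlog2 : 0 < Real.log 2 := Real.log_pos (by norm_num)
  have hK0 : (0 : ℝ) < K := one_pos.trans_le hK
  have hε0 : 0 < ε / Real.sqrt r := by positivity
  have hε2 : ε / Real.sqrt r < 1 := by rw [div_lt_one (by positivity)]; linarith
  refine ⟨⟨hε0, hε2⟩, ⟨Real.exp_pos _, Real.exp_lt_one_iff.2 (by linarith)⟩, fun v => ?_⟩
  have hb := h.measure_forall_norm_sq_deviation_le hK hk v hε0 hε2
  -- Here `4 log(nr)` would do; `524288 = 512 · 1024 = 32 · 16384` is dictated by the restricted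
  -- isometry.
  have hdev : 512 * Real.log (n * r) ≤ k * (ε / Real.sqrt r) ^ 2 / (1024 * (K : ℝ) ^ 2) := by
    rw [div_pow, Real.sq_sqrt (by positivity), le_div_iff₀ (by positivity)]
    calc 512 * Real.log (n * r) * (1024 * (K : ℝ) ^ 2)
        = 524288 * (K : ℝ) ^ 2 * ((ε ^ 2)⁻¹ * r * Real.log (n * r)) * (ε ^ 2 / r) := by
          field_simp
          ring
      _ ≤ _ := by gcongr
  have htail : (Fintype.card (Fin (2 * n * r)) : ℝ) *
      (2 * Real.exp (-(k * (ε / Real.sqrt r) ^ 2 / (1024 * (K : ℝ) ^ 2)))) ≤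
        Real.exp (-Real.log (n * r)) := by
    refine le_trans (le_of_eq ?_) (four_mul_exp_neg_le (x := Real.log (n * r))
      (y := k * (ε / Real.sqrt r) ^ 2 / (1024 * (K : ℝ) ^ 2)) ?_)
    · rw [Real.exp_log (by linarith), Fintype.card_fin]
      push_cast
      ring
    · rw [log_four_eq]
      linarith
  refine (sub_le_sub_left (hb.trans htail) 1).trans ((one_sub_measureReal_compl_le _).trans ?_)
  refine measureReal_mono fun ω hω i => ?_
  have := abs_le.1 (hω i)
  constructor <;> linarith

/-- Taking roots loses nothing: `(1 - ε)² ≤ 1 - ε` and `1 + ε ≤ (1 + ε)²`. -/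
lemma norm_bounds_of_abs_sq_sub_le {a b ε : ℝ} (ha : 0 ≤ a) (hb : 0 ≤ b) (hε : 0 < ε)
    (hε1 : ε < 1) (h : |a ^ 2 - b ^ 2| ≤ ε * b ^ 2) : (1 - ε) * b ≤ a ∧ a ≤ (1 + ε) * b := by
  have hb2 := sq_nonneg b
  rw [abs_le] at h
  constructor
  · refine le_of_abs_le (abs_le_of_sq_le_sq ?_ ha)
    nlinarith [mul_nonneg (mul_nonneg hε.le (by linarith : 0 ≤ 1 - ε)) hb2]
  · refine le_of_abs_le (abs_le_of_sq_le_sq ?_ (by positivity))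
    nlinarith [mul_nonneg hε.le hb2, mul_nonneg (mul_nonneg hε.le hε.le) hb2]

lemma HasIIDSubgaussianEntries.isRestrictedIsometry (h : HasIIDSubgaussianEntries P R K)
    (hK : 1 ≤ K) (hk : 0 < k) (hr : 1 ≤ r) {ε M Q : ℝ} (hε : 0 < ε) (hε1 : ε < 1)
    (hrM : r ≤ M) (hMQ : Real.log 2 * M ≤ Q) (hkQ : 524288 * (K : ℝ) ^ 2 * Q ≤ k)
    (hkM : 524288 * (K : ℝ) ^ 2 * ((ε ^ 2)⁻¹ * Real.log ε⁻¹ * M) ≤ k) :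
    IsRestrictedIsometry P R r ε (Real.exp (-(Real.log ε⁻¹ * M))) := by
  have hr1 : (1 : ℝ) ≤ r := by exact_mod_cast hr
  have hK0 : (0 : ℝ) < K := one_pos.trans_le hK
  have hM1 : 1 ≤ M := hr1.trans hrM
  have hlog2 : 0 < Real.log 2 := Real.log_pos (by norm_num)
  have hL : 0 < Real.log ε⁻¹ := Real.log_pos ((one_lt_inv₀ hε).2 hε1)
  have hA : (0 : ℝ) < 16384 * (K : ℝ) ^ 2 := by positivity
  have hC : 524288 * (K : ℝ) ^ 2 = 32 * (16384 * (K : ℝ) ^ 2) := by ring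
  rw [hC] at hkQ hkM
  refine ⟨⟨hε, hε1⟩, ⟨Real.exp_pos _, Real.exp_lt_one_iff.2 (by nlinarith)⟩, fun V hV => ?_⟩
  obtain ⟨η, hη, hηε, htail⟩ : ∃ η : ℝ, 0 < η ∧ η ≤ ε ∧
      4 * 25 ^ r * Real.exp (-(k * η ^ 2 / (16384 * (K : ℝ) ^ 2))) ≤
        Real.exp (-(Real.log ε⁻¹ * M)) := by
    rcases le_total ε (1 / 2) with h2 | h2
    · exact ⟨ε, hε, le_rfl, restrictedIsometry_tail_le_of_le_half hA hM1 hrM hε h2 hkM⟩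
    · exact ⟨1 / 2, by norm_num, h2, restrictedIsometry_tail_le_of_half_le hA hr h2 hε1
        (by linarith) hMQ ((mul_le_mul_of_nonneg_left hrM hlog2.le).trans hMQ) hkQ⟩
  have hb := h.measure_subspace_deviation_le hK hk V hη (hηε.trans_lt hε1)
  rw [hV] at hb
  refine (sub_le_sub_left (hb.trans htail) 1).trans ((one_sub_measureReal_compl_le _).trans ?_)
  refine measureReal_mono fun ω hω v hv => ?_
  exact norm_bounds_of_abs_sq_sub_le (norm_nonneg _) (norm_nonneg _) hε hε1
    ((hω v hv).trans (by gcongr))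

lemma HasIIDSubgaussianEntries.isJLT_and_isRestrictedIsometry
    (h : HasIIDSubgaussianEntries P R K) (hK : 1 ≤ K) (hnr : 2 ≤ n * r) {ε₁ ε₂ M : ℝ}
    (hε₁ : 0 < ε₁) (hε₁1 : ε₁ < 1) (hε₂ : 0 < ε₂) (hε₂1 : ε₂ < 1)
    (hrM : r ≤ M) (hM : M ≤ max (r : ℝ) (Real.log n))
    (hk : 524288 * (K : ℝ) ^ 2 * max ((ε₁ ^ 2)⁻¹ * r * (Real.log r + Real.log n))
      ((ε₂ ^ 2)⁻¹ * Real.log (ε₂⁻¹) * M) ≤ k) :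
    IsJLT P R (2 * n * r) (ε₁ / Real.sqrt r) (Real.exp (-1 * Real.log ((n : ℝ) * r))) ∧
      IsRestrictedIsometry P R r ε₂ (Real.exp (-1 * Real.log (ε₂⁻¹) * M)) := by
  have hr : 0 < r := Nat.pos_of_mul_pos_left (a := n) (by omega)
  have hn : 0 < n := Nat.pos_of_mul_pos_right (b := r) (by omega)
  have hr1 : (1 : ℝ) ≤ r := by exact_mod_cast hr
  have hn1 : (1 : ℝ) ≤ n := by exact_mod_cast hn
  have hK0 : (0 : ℝ) < K := one_pos.trans_le hK
  have hnr' : (2 : ℝ) ≤ n * r := by exact_mod_cast hnr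
  have hlog : Real.log 2 ≤ Real.log (n * r) := Real.log_le_log (by norm_num) hnr'
  have hlog2 : 0 < Real.log 2 := Real.log_pos (by norm_num)
  have hlog2' : Real.log 2 ≤ 1 := by linarith [Real.log_two_lt_d9]
  have hadd : Real.log r + Real.log n = Real.log (n * r) := by
    rw [Real.log_mul (by positivity) (by positivity), add_comm]
  have hlog0 : 0 ≤ Real.log (n * r) := hlog2.le.trans hlog
  have hM0 : 0 ≤ M := by linarith
  rw [hadd] at hk
  have hk1 : 524288 * (K : ℝ) ^ 2 * ((ε₁ ^ 2)⁻¹ * r * Real.log (n * r)) ≤ k :=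
    le_trans (by gcongr; exact le_max_left _ _) hk
  have hk2 : 524288 * (K : ℝ) ^ 2 * ((ε₂ ^ 2)⁻¹ * Real.log ε₂⁻¹ * M) ≤ k :=
    le_trans (by gcongr; exact le_max_right _ _) hk
  have hinv : 1 ≤ (ε₁ ^ 2)⁻¹ := (one_le_inv₀ (by positivity)).2 (by nlinarith)
  have hkQ : 524288 * (K : ℝ) ^ 2 * (r * Real.log (n * r)) ≤ k := by
    refine le_trans ?_ hk1
    rw [mul_assoc (ε₁ ^ 2)⁻¹]
    exact mul_le_mul_of_nonneg_left (le_mul_of_one_le_left (by positivity) hinv) (by positivity)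
  -- Positivity of `k` is not assumed; it follows from `log(nr) > 0`.
  have hk0 : 0 < k := by
    have : (0 : ℝ) < k := lt_of_lt_of_le (by have := hlog2.trans_le hlog; positivity) hkQ
    exact_mod_cast this
  have hMQ : Real.log 2 * M ≤ r * Real.log (n * r) := by
    rcases le_max_iff.1 hM with h1 | h1
    · calc Real.log 2 * M ≤ Real.log (n * r) * r := by gcongr
        _ = _ := mul_comm _ _
    · have h2 : Real.log n ≤ Real.log (n * r) :=
        Real.log_le_log (by positivity) (le_mul_of_one_le_right (by positivity) hr1)
      calc Real.log 2 * M ≤ 1 * Real.log (n * r) := by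
            gcongr
            exact h1.trans h2
        _ ≤ _ := by gcongr
  rw [neg_one_mul, neg_one_mul, neg_mul]
  exact ⟨h.isJLT hK hk0 hnr hε₁ hε₁1 hk1,
    h.isRestrictedIsometry hK hk0 hr hε₂ hε₂1 hrM hMQ hkQ hk2⟩

end Main

theorem proposition1 :
    ∃ c : ℝ, 0 < c ∧ ∃ c' : ℝ, 0 < c' ∧ ∀ K : ℝ≥0, ∃ C : ℝ, 0 < C ∧
      ∀ (Ω : Type*) [MeasurableSpace Ω] (P : Measure Ω) [IsProbabilityMeasure P]
        (d k n r : ℕ) (R : Ω → Matrix (Fin d) (Fin k) ℝ) (ε₁ ε₂ : ℝ),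
        2 ≤ n * r → 0 < ε₁ → ε₁ < 1 → 0 < ε₂ → ε₂ < 1 →
        HasIIDSubgaussianEntries P R K →
        (C * max ((ε₁ ^ 2)⁻¹ * r * (Real.log r + Real.log n))
              ((ε₂ ^ 2)⁻¹ * Real.log (ε₂⁻¹) * r) ≤ k →
          IsJLT P R (2 * n * r) (ε₁ / Real.sqrt r) (Real.exp (-c' * Real.log ((n : ℝ) * r))) ∧
          IsRestrictedIsometry P R r ε₂ (Real.exp (-c * Real.log (ε₂⁻¹) * r))) ∧
        (C * max ((ε₁ ^ 2)⁻¹ * r * (Real.log r + Real.log n))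
              ((ε₂ ^ 2)⁻¹ * Real.log (ε₂⁻¹) * max (r : ℝ) (Real.log n)) ≤ k →
          IsJLT P R (2 * n * r) (ε₁ / Real.sqrt r) (Real.exp (-c' * Real.log ((n : ℝ) * r))) ∧
          IsRestrictedIsometry P R r ε₂
            (Real.exp (-c * Real.log (ε₂⁻¹) * max (r : ℝ) (Real.log n)))) := by
  -- The Bernstein bound needs a parameter at least 1, so `K` is enlarged to `max K 1`.
  refine ⟨1, one_pos, 1, one_pos, fun K => ⟨524288 * ((max K 1 : ℝ≥0) : ℝ) ^ 2, by positivity,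
    fun Ω _ P _ d k n r R ε₁ ε₂ hnr hε₁ hε₁1 hε₂ hε₂1 h => ?_⟩⟩
  have h' := h.mono (le_max_left K 1)
  exact ⟨fun hk => h'.isJLT_and_isRestrictedIsometry (le_max_right K 1) hnr hε₁ hε₁1 hε₂ hε₂1
      le_rfl (le_max_left _ _) hk,
    fun hk => h'.isJLT_and_isRestrictedIsometry (le_max_right K 1) hnr hε₁ hε₁1 hε₂ hε₂1
      (le_max_left _ _) le_rfl hk⟩
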